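/- Let $p$ be an odd prime, $R=\mathbb{Z}_p[[q-1]]$ and $Q=\operatorname{Frac}(R)$. Let $[n]_q=1+q+\cdots+q^{n-1}$ for $n\in\mathbb{N}=\{0,1,2,\dots\}$. Let $\varphi$ be the Frobenius endomorphism of $R$ that fixes $\mathbb{Z}_p$ and sends $q-1$ to $q^p-1$ (that is, $\varphi(\sum_i a_i(q-1)^i)=\sum_i a_i(q^p-1)^i$ for $a_i\in\mathbb{Z}_p$), extended to $R[\lambda]$ by $\varphi(\lambda)=\lambda^p$. For $g\in R[\lambda]\setminus(p,q-1)R[\lambda]$ let $R\langle\lambda,\frac1{g(\lambda)}\rangle$ be the $(p,q-1)$-adic completion of $R[\lambda,\frac1{g(\lambda)}]$, with its $(p,q-1)$-adic topology. Let $B\colon\mathbb{N}\to R$ be a map with $B(0)=1$ such that for all $n,m,s\in\mathbb{N}$ $$\frac{B(n+mp^{s+1})}{\varphi\bigl(B(\lfloor n/p\rfloor+mp^s)\bigr)}\equiv\frac{B(n)}{\varphi\bigl(B(\lfloor n/p\rfloor)\bigr)}\pmod{[p^{s+1}]_qR}\qquad\text{and}\qquad\frac{B(n)}{\varphi\bigl(B(\lfloor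 n/p\rfloor)\bigr)}\in R,$$ where the quotients are taken in $Q$ (their denominators being nonzero) and $x\equiv y \pmod{aR}$ means $x-y\in aR$. For $s\in\mathbb{N}$ put $F_s(\lambda)=\sum_{j=0}^{p^s-1}B(j)\lambda^j\in R[\lambda]$, and let $T=R\langle\lambda,\frac1{F_1(\lambda)}\rangle$. Then $\varphi(F_s(\lambda))$ is invertible in $T$ for every $s\in\mathbb{N}$, and the sequence $$\frac{F_{s+1}(\lambda)}{\varphi(F_s(\lambda))}\qquad(s\in\mathbb{N})$$ converges in $T$, as $s\to\infty$, to a unit of $T$. -/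

import Mathlib

open Filter Polynomial

noncomputable section

namespace QDwork

variable (p : ℕ) [Fact p.Prime]

/-- The ring `R = ℤ_p[[q - 1]]`; the power series variable is `q - 1`. -/
abbrev R : Type := PowerSeries ℤ_[p]

/-- The element `q = 1 + (q - 1)` of `R`. -/
def q : R p := 1 + PowerSeries.X

/-- The `q`-number `[n]_q = 1 + q + ⋯ + q ^ (n - 1)` of a natural number `n`. -/
def qNum (n : ℕ) : R p := ∑ i ∈ Finset.range n, q p ^ i

theorem hasSubst_q_pow : PowerSeries.HasSubst (q p ^ p - 1 : R p) :=
  PowerSeries.HasSubst.of_constantCoeff_zero' (by simp [q])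

/-- The Frobenius endomorphism of `R`: it fixes `ℤ_p` and substitutes `q ^ p - 1` for
`q - 1`, that is, `φ (∑ aᵢ (q - 1) ^ i) = ∑ aᵢ (q ^ p - 1) ^ i`. -/
def frob : R p →+* R p := (PowerSeries.substAlgHom (R := ℤ_[p]) (hasSubst_q_pow p)).toRingHom

theorem frob_q : frob p (q p) = q p ^ p := by
  have h : frob p PowerSeries.X = q p ^ p - 1 :=
    PowerSeries.substAlgHom_X (hasSubst_q_pow p)
  rw [q, map_add, map_one, h, q]
  ring

theorem frob_C (a : ℤ_[p]) : frob p (PowerSeries.C a) = PowerSeries.C a :=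
  (PowerSeries.substAlgHom (R := ℤ_[p]) (hasSubst_q_pow p)).commutes a

/-- The Frobenius endomorphism of `R[λ]`: it is `frob` on coefficients and sends `λ` to
`λ ^ p`. -/
def polyFrob : (R p)[X] →+* (R p)[X] := eval₂RingHom (C.comp (frob p)) (X ^ p)

variable {p}

/-- `CongrModR x y a` says that `x ≡ y mod aR`, for `x, y` in the fraction field `Q` of `R`
and `a` in `R`. -/
def CongrModR (x y : FractionRing (R p)) (a : R p) : Prop :=
  ∃ r : R p, x - y = algebraMap (R p) (FractionRing (R p)) (a * r)

/-- The ratio `B(n) / φ(B(m))` in the fraction field `Q` of `R`. -/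
def ratio (B : ℕ → R p) (n m : ℕ) : FractionRing (R p) :=
  algebraMap (R p) (FractionRing (R p)) (B n) /
    algebraMap (R p) (FractionRing (R p)) (frob p (B m))

/-- The truncation `F_s(λ) = ∑_{j < p ^ s} B(j) λ ^ j`. -/
def truncF (B : ℕ → R p) (s : ℕ) : (R p)[X] :=
  ∑ j ∈ Finset.range (p ^ s), C (B j) * X ^ j

/-- The ideal of `R[λ, 1/g]` generated by `p` and `q - 1`. -/
def idealLoc (g : (R p)[X]) : Ideal (Localization.Away g) :=
  Ideal.span {algebraMap (R p)[X] (Localization.Away g) (C (p : R p)),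
    algebraMap (R p)[X] (Localization.Away g) (C (q p - 1))}

/-- The ring `R⟨λ, 1/g⟩`: the `(p, q - 1)`-adic completion of `R[λ, 1/g]`. -/
abbrev Compl (g : (R p)[X]) : Type := AdicCompletion (idealLoc g) (Localization.Away g)

/-- The canonical ring homomorphism `R[λ] → R⟨λ, 1/g⟩`. -/
def toCompl (g : (R p)[X]) : (R p)[X] →+* Compl g :=
  (algebraMap (Localization.Away g) (Compl g)).comp (algebraMap (R p)[X] (Localization.Away g))

/-- The ideal of `R⟨λ, 1/g⟩` generated by `p` and `q - 1`. -/
def idealCompl (g : (R p)[X]) : Ideal (Compl g) :=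
  Ideal.span {toCompl g (C (p : R p)), toCompl g (C (q p - 1))}

/-- Convergence in the `(p, q - 1)`-adic topology of `R⟨λ, 1/g⟩`. -/
def ConvergesTo (g : (R p)[X]) (f : ℕ → Compl g) (l : Compl g) : Prop :=
  Tendsto f atTop (@nhds (Compl g) (idealCompl g).adicTopology l)

end QDwork

end

/-! Put `I = (p, q - 1)`. The ratios `a n = B n / φ(B (n / p))` lie in `R`, and since `[p^s]_q ∈
I^s` they are `p`-adically continuous: `m ≡ n mod p^s` gives `a m ≡ a n mod I^s`. Peeling base-`p`
digits off `B` with this control (`digit_expansion`) yields, in `truncF_succ`, the recurrence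
`F_{s+1} = ∑_{L ≤ s} W_L φ^{L+1}(F_{s-L})` with `W_L ∈ I^L`.

Everything else follows from the recurrence. Modulo `I` only `L = 0` survives and `W_0 = F_1`, so
each `φ^i(F_s)` is a product of Frobenius twists of `F_1`, hence a unit in `T`. Expanding
consecutive `F`'s by the recurrence gives Dwork's congruences `F_{s+2} φ(F_s) ≡ F_{s+1} φ(F_{s+1})
mod I^{s+1}` (`cross_congr`). The ratios are therefore Cauchy, with limit congruent to the unit
`F_1`. -/

noncomputable section

namespace QDwork

/-! ### Dwork congruences and limits in an adically complete ring -/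

section Abstract

variable {S : Type*} [CommRing S] {J : Ideal S}

/-- If `u i s` decomposes as `∑ w i L * u (i + L + 1) (s - 1 - L)` with `w i L ∈ J ^ L`, then the
ratios `u i (t + k) / u (i + k) t` do not depend on `t` modulo `J ^ (t + 1)`. -/
theorem cross_congr {u w : ℕ → ℕ → S} (hu : ∀ i s, IsUnit (u i s))
    (hw : ∀ i L, w i L ∈ J ^ L)
    (hrec : ∀ i s, u i (s + 1) = ∑ L ∈ Finset.range (s + 1), w i L * u (i + L + 1) (s - L))
    (s : ℕ) : ∀ i k t, k + t = s →
      u i (s + 1) * u (i + k) t - u i s * u (i + k) (t + 1) ∈ J ^ (t + 1) := by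
  induction s with
  | zero =>
    intro i k t h
    obtain ⟨rfl, rfl⟩ : k = 0 ∧ t = 0 := by omega
    simp [mul_comm]
  | succ s ih =>
    -- The case `k = 1`: after expanding both leading factors, the `L`-th term is `w i L ∈ J ^ L`
    -- times an inductive cross difference in `J ^ (s - L + 1)`; the unmatched last term is in `J ^
    -- (s + 1)` already.
    have key : ∀ i, u i (s + 2) * u (i + 1) s - u i (s + 1) * u (i + 1) (s + 1) ∈ J ^ (s + 1) := by
      intro i
      have e : u i (s + 2) * u (i + 1) s - u i (s + 1) * u (i + 1) (s + 1) =
          (∑ L ∈ Finset.range (s + 1), w i L *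
            (u (i + L + 1) (s + 1 - L) * u (i + 1) s - u (i + L + 1) (s - L) * u (i + 1) (s + 1)))
          + w i (s + 1) * (u (i + (s + 1) + 1) 0 * u (i + 1) s) := by
        rw [hrec i (s + 1), hrec i s, Finset.sum_range_succ, Nat.sub_self, add_mul, Finset.sum_mul,
          Finset.sum_mul, add_sub_right_comm, ← Finset.sum_sub_distrib]
        congr 1
        · exact Finset.sum_congr rfl fun L _ => by ring
        · ring
      rw [e]
      refine Ideal.add_mem _ (Ideal.sum_mem _ fun L hL => ?_) (Ideal.mul_mem_right _ _ (hw _ _))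
      have hL' : L ≤ s := by simpa [Nat.lt_succ_iff] using hL
      have h := ih (i + 1) L (s - L) (by omega)
      have h2 : u (i + L + 1) (s + 1 - L) * u (i + 1) s
          - u (i + L + 1) (s - L) * u (i + 1) (s + 1) ∈ J ^ (s - L + 1) := by
        rw [← neg_mem_iff]
        convert h using 1
        rw [show i + 1 + L = i + L + 1 by ring, show s + 1 - L = s - L + 1 by omega]
        ring
      rw [show s + 1 = L + (s - L + 1) by omega, pow_add]
      exact Ideal.mul_mem_mul (hw _ _) (by rwa [show L + (s - L + 1) = s + 1 by omega])
    intro i k t h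
    cases k with
    | zero =>
      obtain rfl : t = s + 1 := by omega
      simp [mul_comm]
    | succ k =>
      have h1 := Ideal.pow_le_pow_right (show t + 1 ≤ s + 1 by omega) (key i)
      have h2 := ih (i + 1) k t (by omega)
      -- Ratios compose: `key` compares levels `i` and `i + 1`, `ih` compares `i + 1` and `i + 1 +
      -- k`, and the common factor `u (i + 1) s` cancels.
      rw [← Ideal.unit_mul_mem_iff_mem _ (hu (i + 1) s)]
      have h3 := Ideal.add_mem _ (Ideal.mul_mem_left _ (u (i + 1 + k) t) h1)
        (Ideal.mul_mem_left _ (u i (s + 1)) h2)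
      rw [show i + (k + 1) = i + 1 + k by ring]
      convert h3 using 1
      ring

theorem isUnit_of_sub_mem [IsAdicComplete J S] {x y : S} (hy : IsUnit y) (h : x - y ∈ J) :
    IsUnit x := by
  have hj := IsAdicComplete.le_jacobson_bot J h
  obtain ⟨v, rfl⟩ := hy
  have := Ideal.mem_jacobson_bot.1 hj ↑v⁻¹
  rw [sub_mul, v.mul_inv, sub_add_cancel] at this
  exact isUnit_of_mul_isUnit_left this

theorem exists_limit [IsAdicComplete J S] {v : ℕ → S} (h : ∀ s, v (s + 1) - v s ∈ J ^ (s + 1)) :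
    ∃ l, ∀ s, v s - l ∈ J ^ (s + 1) := by
  have hc : ∀ m k, v (m + k) - v m ∈ J ^ (m + 1) := by
    intro m k
    induction k with
    | zero => simp
    | succ k ih =>
      have := Ideal.add_mem _ (Ideal.pow_le_pow_right (by omega) (h (m + k))) ih
      rwa [sub_add_sub_cancel] at this
  obtain ⟨l, hl⟩ := IsPrecomplete.prec' (I := J) (M := S) v (fun {m n} hmn => by
    obtain ⟨k, rfl⟩ := Nat.exists_eq_add_of_le hmn
    rw [SModEq.comm, SModEq.sub_mem, smul_eq_mul, Ideal.mul_top]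
    exact Ideal.pow_le_pow_right (by omega) (hc m k))
  refine ⟨l, fun s => ?_⟩
  have h1 := hl (s + 1)
  rw [SModEq.sub_mem, smul_eq_mul, Ideal.mul_top] at h1
  have := Ideal.sub_mem _ h1 (h s)
  rwa [sub_sub_sub_cancel_left] at this

theorem tendsto_adic {v : ℕ → S} {l : S} (h : ∀ s, v s - l ∈ J ^ (s + 1)) :
    Tendsto v atTop (@nhds S J.adicTopology l) := by
  let _ := J.adicTopology
  refine (J.hasBasis_nhds_adic l).tendsto_right_iff.2 fun n _ => ?_
  filter_upwards [eventually_ge_atTop n] with s hs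
  exact ⟨v s - l, Ideal.pow_le_pow_right (by omega) (h s), by simp⟩

end Abstract

variable (p : ℕ) [Fact p.Prime]

/-! ### Frobenius and the ideal `(p, q - 1)` -/

/-- The ideal `(p, q - 1)` of `R`. -/
def idealR : Ideal (R p) := Ideal.span {(p : R p), q p - 1}

theorem natCast_mem_idealR : (p : R p) ∈ idealR p := Ideal.subset_span (by simp)

theorem q_sub_one_mem_idealR : q p - 1 ∈ idealR p := Ideal.subset_span (by simp)

theorem q_pow_sub_one_mem_idealR (n : ℕ) : q p ^ n - 1 ∈ idealR p :=
  Ideal.mem_of_dvd _ (by simpa using sub_dvd_pow_sub_pow (q p) 1 n) (q_sub_one_mem_idealR p)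

theorem idealR_ne_top : idealR p ≠ ⊤ := by
  intro h
  have hle : idealR p ≤ Ideal.comap (PowerSeries.constantCoeff (R := ℤ_[p]))
      (IsLocalRing.maximalIdeal ℤ_[p]) := by
    rw [idealR, Ideal.span_le]
    rintro x (rfl | rfl)
    · simp [PadicInt.maximalIdeal_eq_span_p]
    · simp [q]
  rw [h, top_le_iff] at hle
  exact Ideal.comap_ne_top _ (Ideal.IsPrime.ne_top inferInstance) hle

theorem frob_mem_idealR_pow {n : ℕ} {x : R p} (hx : x ∈ idealR p ^ n) :
    frob p x ∈ idealR p ^ n := by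
  have h : (idealR p).map (frob p) ≤ idealR p := by
    nth_rewrite 1 [idealR]
    rw [Ideal.map_span, Ideal.span_le]
    rintro _ ⟨x, rfl | rfl, rfl⟩
    · simpa using natCast_mem_idealR p
    · rw [map_sub, map_one, frob_q]
      exact q_pow_sub_one_mem_idealR p p
  have h2 := Ideal.mem_map_of_mem (frob p) hx
  rw [Ideal.map_pow] at h2
  exact Ideal.pow_right_mono h n h2

theorem frob_pow_mem_idealR_pow (k : ℕ) {n : ℕ} {x : R p} (hx : x ∈ idealR p ^ n) :
    (frob p ^ k) x ∈ idealR p ^ n := by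
  induction k with
  | zero => exact hx
  | succ k ih => rw [pow_succ', RingHom.mul_def]; exact frob_mem_idealR_pow p ih

theorem qNum_mul (n : ℕ) : qNum p n * (q p - 1) = q p ^ n - 1 := geom_sum_mul _ _

/-- Each factor in `[p^(s+1)]_q = [p^s]_q * ∑_{i<p} q^(p^s i)` contributes one power, because the
last sum is `p` modulo `q - 1`. -/
theorem qNum_prime_pow_mem (s : ℕ) : qNum p (p ^ s) ∈ idealR p ^ s := by
  induction s with
  | zero => simp
  | succ s ih =>
    have hX : q p - 1 ≠ 0 := by simp [q]
    have h : qNum p (p ^ (s + 1)) =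
        qNum p (p ^ s) * ∑ i ∈ Finset.range p, (q p ^ p ^ s) ^ i := by
      refine mul_right_cancel₀ hX ?_
      rw [qNum_mul, mul_right_comm, qNum_mul, mul_comm, geom_sum_mul, ← pow_mul, pow_succ]
    rw [h, pow_succ]
    refine Ideal.mul_mem_mul ih ?_
    have e : ∑ i ∈ Finset.range p, (q p ^ p ^ s) ^ i =
        ∑ i ∈ Finset.range p, (q p ^ (p ^ s * i) - 1) + (p : R p) := by
      simp [Finset.sum_sub_distrib, pow_mul]
    rw [e]
    exact Ideal.add_mem _ (Ideal.sum_mem _ fun i _ => q_pow_sub_one_mem_idealR p _)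
      (natCast_mem_idealR p)

theorem frob_sub_pow_mem (x : R p) : frob p x - x ^ p ∈ idealR p := by
  obtain ⟨y, hy⟩ : PowerSeries.X ∣ x - PowerSeries.C (PowerSeries.constantCoeff x) := by
    rw [PowerSeries.X_dvd_iff]; simp
  set c := PowerSeries.constantCoeff x
  have hX : (PowerSeries.X : R p) = q p - 1 := by simp [q]
  have hxc : x - PowerSeries.C c ∈ idealR p := by
    rw [hy, hX]; exact Ideal.mul_mem_right _ _ (q_sub_one_mem_idealR p)
  have h1 : frob p x - PowerSeries.C c ∈ idealR p := by
    have := frob_mem_idealR_pow p ((pow_one (idealR p)).symm ▸ hxc)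
    rwa [map_sub, frob_C, pow_one] at this
  have h2 : x ^ p - PowerSeries.C c ^ p ∈ idealR p :=
    Ideal.mem_of_dvd _ (sub_dvd_pow_sub_pow _ _ p) hxc
  have h3 : PowerSeries.C c ^ p - PowerSeries.C c ∈ idealR p := by
    have hc : c ^ p - c ∈ IsLocalRing.maximalIdeal ℤ_[p] := by
      rw [← PadicInt.ker_toZMod, RingHom.mem_ker, map_sub, map_pow, ZMod.pow_card, sub_self]
    rw [PadicInt.maximalIdeal_eq_span_p, Ideal.mem_span_singleton] at hc
    obtain ⟨d, hd⟩ := hc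
    rw [← map_pow, ← map_sub, hd, map_mul, map_natCast]
    exact Ideal.mul_mem_right _ _ (natCast_mem_idealR p)
  have := Ideal.sub_mem _ (Ideal.sub_mem _ h1 h2) h3
  convert this using 1
  ring

/-- The ideal `(p, q - 1)` of `R[λ]`. -/
def idealPoly : Ideal (R p)[X] := (idealR p).map C

theorem C_mem_idealPoly_pow {n : ℕ} {x : R p} (hx : x ∈ idealR p ^ n) :
    C x ∈ idealPoly p ^ n := by
  rw [idealPoly, ← Ideal.map_pow]; exact Ideal.mem_map_of_mem _ hx

theorem polyFrob_C (x : R p) : polyFrob p (C x) = C (frob p x) := by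
  simp [polyFrob]

theorem polyFrob_X : polyFrob p X = X ^ p := by
  simp [polyFrob]

theorem polyFrob_pow_C (k : ℕ) (x : R p) : (polyFrob p ^ k) (C x) = C ((frob p ^ k) x) := by
  induction k with
  | zero => rfl
  | succ k ih => simp only [pow_succ', RingHom.mul_def, RingHom.comp_apply, ih, polyFrob_C]

theorem polyFrob_pow_X (k : ℕ) : (polyFrob p ^ k) X = X ^ p ^ k := by
  induction k with
  | zero => simp
  | succ k ih =>
    simp only [pow_succ', RingHom.mul_def, RingHom.comp_apply, ih, map_pow, polyFrob_X]
    rw [← pow_mul]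

theorem polyFrob_pow_mem (k : ℕ) {n : ℕ} {f : (R p)[X]} (hf : f ∈ idealPoly p ^ n) :
    (polyFrob p ^ k) f ∈ idealPoly p ^ n := by
  have h : (idealPoly p).map (polyFrob p ^ k) ≤ idealPoly p := by
    rw [Ideal.map_le_iff_le_comap]
    nth_rewrite 1 [idealPoly]
    rw [Ideal.map_le_iff_le_comap]
    intro x hx
    rw [Ideal.mem_comap, Ideal.mem_comap, polyFrob_pow_C]
    exact Ideal.mem_map_of_mem _ (
      pow_one (idealR p) ▸ frob_pow_mem_idealR_pow p k ((pow_one (idealR p)).symm ▸ hx))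
  have h2 := Ideal.mem_map_of_mem (polyFrob p ^ k) hf
  rw [Ideal.map_pow] at h2
  exact Ideal.pow_right_mono h n h2

theorem polyFrob_sub_pow_mem (f : (R p)[X]) : polyFrob p f - f ^ p ∈ idealPoly p := by
  have hC : ∀ {x : R p}, x ∈ idealR p → C x ∈ idealPoly p := Ideal.mem_map_of_mem _
  induction f using Polynomial.induction_on' with
  | add f g hf hg =>
    obtain ⟨r, hr⟩ := exists_add_pow_prime_eq (Fact.out : p.Prime) f g
    have h : (p : (R p)[X]) ∈ idealPoly p := by simpa using hC (natCast_mem_idealR p)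
    have := Ideal.sub_mem _ (Ideal.add_mem _ hf hg) (Ideal.mul_mem_right (f * g * r) _ h)
    rw [hr, map_add]
    convert this using 1
    ring
  | monomial n a =>
    have := Ideal.mul_mem_right (X ^ (n * p)) _ (hC (frob_sub_pow_mem p a))
    rw [← C_mul_X_pow_eq_monomial, map_mul, map_pow, polyFrob_C, polyFrob_X]
    convert this using 1
    rw [map_sub, map_pow]
    ring

theorem polyFrob_pow_sub_pow_mem (k : ℕ) (f : (R p)[X]) :
    (polyFrob p ^ k) f - f ^ p ^ k ∈ idealPoly p := by
  induction k with
  | zero => simp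
  | succ k ih =>
    have h1 := polyFrob_pow_mem p 1 ((pow_one (idealPoly p)).symm ▸ ih)
    rw [pow_one (idealPoly p), pow_one (polyFrob p), map_sub, map_pow] at h1
    have h2 : polyFrob p f ^ p ^ k - (f ^ p) ^ p ^ k ∈ idealPoly p :=
      Ideal.mem_of_dvd _ (sub_dvd_pow_sub_pow _ _ _) (polyFrob_sub_pow_mem p f)
    have := Ideal.add_mem _ h1 h2
    rw [sub_add_sub_cancel, ← pow_mul, ← pow_succ'] at this
    rwa [pow_succ', RingHom.mul_def]

variable {p}

/-! ### The completed localization -/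

theorem idealCompl_eq_map (g : (R p)[X]) : idealCompl g = (idealPoly p).map (toCompl g) := by
  rw [idealPoly, idealR, Ideal.map_map, Ideal.map_span, Set.image_pair, idealCompl]
  rfl

theorem toCompl_mem {g f : (R p)[X]} {n : ℕ} (hf : f ∈ idealPoly p ^ n) :
    toCompl g f ∈ idealCompl g ^ n := by
  rw [idealCompl_eq_map, ← Ideal.map_pow]; exact Ideal.mem_map_of_mem _ hf

instance isAdicComplete_compl (g : (R p)[X]) : IsAdicComplete (idealCompl g) (Compl g) := by
  classical
  have h : (idealLoc g).map (algebraMap (Localization.Away g) (Compl g)) = idealCompl g :=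
    (Ideal.map_span _ _).trans (by rw [Set.image_pair]; rfl)
  rw [← h, IsAdicComplete.map_algebraMap_iff]
  exact AdicCompletion.isAdicComplete ⟨{_, _}, by rw [Finset.coe_pair]; rfl⟩

theorem isUnit_toCompl_self (g : (R p)[X]) : IsUnit (toCompl g g) := by
  rw [toCompl, RingHom.comp_apply]
  exact (IsLocalization.Away.algebraMap_isUnit g).map _

/-! ### Digit expansion of `B` and the recurrence for `F_s` -/

section Digits

variable (a : ℕ → R p)

/-- The remainder after `s` steps of the expansion of `B` into blocks of digits. -/
def digitRem : ℕ → ℕ → R p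
  | 0, _ => 1
  | s + 1, N => digitRem s N * (frob p ^ s) (a (N / p ^ s)) -
      digitRem s (N % p ^ (s + 1)) * (frob p ^ s) (a (N % p ^ (s + 1) / p ^ s))

/-- The coefficient of a block of `s + 1` digits in the expansion of `B`. -/
def digitCoeff (s N : ℕ) : R p := digitRem a s N * (frob p ^ s) (a (N / p ^ s))

theorem digitRem_succ (s N : ℕ) :
    digitRem a (s + 1) N = digitCoeff a s N - digitCoeff a s (N % p ^ (s + 1)) := by
  rw [digitRem, digitCoeff, digitCoeff]

theorem digitRem_of_lt {s N : ℕ} (h : N < p ^ (s + 1)) : digitRem a (s + 1) N = 0 := by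
  rw [digitRem_succ, Nat.mod_eq_of_lt h, sub_self]

variable {a}

/-- Dividing the argument by `p ^ s` costs `s` digits of congruence for `a`, but the factor
`digitRem a s` in `I ^ s` restores them. Comparing `N` with `N % p ^ (s + 1)` then gains one power
per step. -/
theorem digitRem_congr
    (ha : ∀ s {m n : ℕ}, m ≡ n [MOD p ^ s] → a m - a n ∈ idealR p ^ s) (s : ℕ) :
    (∀ N, digitRem a s N ∈ idealR p ^ s) ∧
    ∀ t M N, s ≤ t → M ≡ N [MOD p ^ t] → digitRem a s M - digitRem a s N ∈ idealR p ^ t := by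
  induction s with
  | zero => simp [digitRem]
  | succ s ih =>
    have hg : ∀ t M N, s ≤ t → M ≡ N [MOD p ^ t] →
        digitCoeff a s M - digitCoeff a s N ∈ idealR p ^ t := by
      intro t M N ht h
      obtain ⟨r, rfl⟩ := Nat.exists_eq_add_of_le ht
      have hd : M / p ^ s ≡ N / p ^ s [MOD p ^ r] := by
        unfold Nat.ModEq at h ⊢
        rw [pow_add] at h
        rw [← Nat.mod_mul_right_div_self, ← Nat.mod_mul_right_div_self, h]
      have h1 := frob_pow_mem_idealR_pow p s (ha r hd)
      have h2 := Ideal.mul_mem_mul (ih.1 N) h1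
      rw [← pow_add] at h2
      have h3 := Ideal.add_mem _
        (Ideal.mul_mem_right ((frob p ^ s) (a (M / p ^ s))) _ (ih.2 _ M N ht h)) h2
      rw [map_sub] at h3
      convert h3 using 1
      rw [digitCoeff, digitCoeff]
      ring
    refine ⟨fun N => ?_, fun t M N ht h => ?_⟩
    · rw [digitRem_succ]
      exact hg _ _ _ (by omega) (Nat.mod_modEq _ _).symm
    · have e : M % p ^ (s + 1) = N % p ^ (s + 1) := h.of_dvd (pow_dvd_pow p ht)
      rw [digitRem_succ, digitRem_succ, e, sub_sub_sub_cancel_right]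
      exact hg t M N (by omega) h

/-- Telescoping: `hB` applied to `N / p ^ s` turns the remainder into `digitCoeff a s N`, which
splits as its value at `N % p ^ (s + 1)` plus the next remainder. -/
theorem digit_expansion {B : ℕ → R p} (hB : ∀ n, B n = a n * frob p (B (n / p))) (N s : ℕ) :
    B N = ∑ L ∈ Finset.range s,
        digitCoeff a L (N % p ^ (L + 1)) * (frob p ^ (L + 1)) (B (N / p ^ (L + 1))) +
      digitRem a s N * (frob p ^ s) (B (N / p ^ s)) := by
  induction s with
  | zero => simp [digitRem]
  | succ s ih =>
    rw [Finset.sum_range_succ, add_assoc, ← add_mul, digitRem_succ, add_sub_cancel]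
    nth_rewrite 1 [ih]
    congr 1
    rw [hB (N / p ^ s), map_mul, Nat.div_div_eq_div_mul, ← pow_succ, ← mul_assoc, digitCoeff,
      pow_succ (frob p), RingHom.mul_def, RingHom.comp_apply]

/-- The polynomial collecting the coefficients of the blocks of `L + 1` digits. -/
def blockPoly (a : ℕ → R p) (L : ℕ) : (R p)[X] :=
  ∑ n ∈ Finset.range (p ^ (L + 1)), C (digitCoeff a L n) * X ^ n

theorem blockPoly_mem (ha : ∀ s {m n : ℕ}, m ≡ n [MOD p ^ s] → a m - a n ∈ idealR p ^ s) (L : ℕ) :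
    blockPoly a L ∈ idealPoly p ^ L :=
  Ideal.sum_mem _ fun n _ => Ideal.mul_mem_right _ _ <|
    C_mem_idealPoly_pow p (Ideal.mul_mem_right _ _ ((digitRem_congr ha L).1 n))

theorem sum_range_mul_eq {M : Type*} [AddCommMonoid M] (f : ℕ → M) (m n : ℕ) :
    ∑ i ∈ Finset.range (m * n), f i =
      ∑ j ∈ Finset.range n, ∑ i ∈ Finset.range m, f (m * j + i) := by
  induction n with
  | zero => simp
  | succ n ih => rw [Nat.mul_succ, Finset.sum_range_add, ih, Finset.sum_range_succ]

/-- The remainder vanishes for `n < p ^ (s + 1)`, and writing `n = p ^ (L + 1) * j + i` factors the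
`L`-th sum into a block part in `i` and a Frobenius twist in `j`. -/
theorem truncF_succ {B : ℕ → R p} (hB : ∀ n, B n = a n * frob p (B (n / p))) (s : ℕ) :
    truncF B (s + 1) = ∑ L ∈ Finset.range (s + 1),
      blockPoly a L * (polyFrob p ^ (L + 1)) (truncF B (s - L)) := by
  have h : truncF B (s + 1) = ∑ n ∈ Finset.range (p ^ (s + 1)), ∑ L ∈ Finset.range (s + 1),
      C (digitCoeff a L (n % p ^ (L + 1)) * (frob p ^ (L + 1)) (B (n / p ^ (L + 1)))) * X ^ n := by
    refine Finset.sum_congr rfl fun n hn => ?_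
    rw [← Finset.sum_mul, ← map_sum, digit_expansion hB n (s + 1),
      digitRem_of_lt a (Finset.mem_range.1 hn), zero_mul, add_zero]
  rw [h, Finset.sum_comm]
  refine Finset.sum_congr rfl fun L hL => ?_
  have hL' : L ≤ s := by simpa [Nat.lt_succ_iff] using hL
  have hp : 0 < p ^ (L + 1) := pow_pos (Fact.out : p.Prime).pos _
  rw [show s + 1 = (L + 1) + (s - L) by omega, pow_add, sum_range_mul_eq, blockPoly, truncF,
    map_sum, Finset.sum_mul_sum, Finset.sum_comm]
  refine Finset.sum_congr rfl fun i hi => Finset.sum_congr rfl fun j _ => ?_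
  have hi' := Finset.mem_range.1 hi
  rw [Nat.mul_add_mod, Nat.mod_eq_of_lt hi', Nat.mul_add_div hp, Nat.div_eq_of_lt hi', add_zero,
    map_mul, map_mul, polyFrob_pow_C, map_pow, polyFrob_pow_X, ← pow_mul, pow_add]
  ring

end Digits

/-- The hypotheses on the ratios `B(n) / φ(B(⌊n / p⌋))` give a factorization of `B` whose factors
satisfy the Dwork congruences modulo the powers of `(p, q - 1)`. -/
theorem exists_factorization {B : ℕ → R p}
    (ha : ∀ n m s : ℕ, CongrModR (ratio B (n + m * p ^ (s + 1)) (n / p + m * p ^ s))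
      (ratio B n (n / p)) (qNum p (p ^ (s + 1))))
    (hb : ∀ n : ℕ, ∃ r : R p, ratio B n (n / p) = algebraMap (R p) (FractionRing (R p)) r)
    (hd : B 0 = 1) :
    ∃ a : ℕ → R p, (∀ n, B n = a n * frob p (B (n / p))) ∧
      ∀ s {m n : ℕ}, m ≡ n [MOD p ^ s] → a m - a n ∈ idealR p ^ s := by
  have hp : 0 < p := (Fact.out : p.Prime).pos
  have inj := IsFractionRing.injective (R p) (FractionRing (R p))
  choose a ha' using hb
  -- If the denominator vanished, the quotient would be `0` by convention, and `ha` at `n = s = 0`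
  -- would give `1 ∈ [p]_q R`, inside a proper ideal.
  have hne : ∀ m, frob p (B m) ≠ 0 := by
    intro m hm
    obtain ⟨r, hr⟩ := ha 0 m 0
    simp only [ratio, hm, hd, zero_add, Nat.zero_div, pow_zero, mul_one, map_zero, div_zero,
      map_one, zero_sub, div_one] at hr
    have h1 : (1 : R p) = -(qNum p (p ^ 1) * r) := inj (by rw [map_neg, ← hr]; simp)
    refine idealR_ne_top p ((Ideal.eq_top_iff_one _).2 ?_)
    rw [h1]
    have := qNum_prime_pow_mem p 1
    rw [pow_one (idealR p)] at this
    exact neg_mem (Ideal.mul_mem_right _ _ this)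
  have hstep : ∀ n m s, a (n + m * p ^ s) - a n ∈ idealR p ^ s := by
    intro n m s
    cases s with
    | zero => simp
    | succ s =>
      have h := ha n m s
      have e : n / p + m * p ^ s = (n + m * p ^ (s + 1)) / p := by
        rw [pow_succ, ← mul_assoc, Nat.add_mul_div_right _ _ hp]
      rw [e, ha', ha'] at h
      obtain ⟨r, hr⟩ := h
      rw [← map_sub] at hr
      rw [inj hr]
      exact Ideal.mul_mem_right _ _ (qNum_prime_pow_mem p _)
  refine ⟨a, fun n => inj ?_, fun s m n h => ?_⟩
  · rw [map_mul, ← ha' n, ratio, div_mul_cancel₀]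
    exact fun h => hne _ (inj (by rw [h, map_zero]))
  · have h1 := hstep (m % p ^ s) (m / p ^ s) s
    have h2 := hstep (n % p ^ s) (n / p ^ s) s
    rw [Nat.mod_add_div'] at h1 h2
    rw [← h] at h2
    have := Ideal.sub_mem _ h1 h2
    rwa [sub_sub_sub_cancel_right] at this

/-- Convergence of the ratios `F_{s+1} / φ(F_s)` to a unit, in any complete ring in which `F_1` is
invertible. -/
theorem exists_unit_tendsto {S : Type*} [CommRing S] {J : Ideal S} [IsAdicComplete J S]
    {τ : (R p)[X] →+* S} (hτ : ∀ {n f}, f ∈ idealPoly p ^ n → τ f ∈ J ^ n) {B : ℕ → R p}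
    (ha : ∀ n m s : ℕ, CongrModR (ratio B (n + m * p ^ (s + 1)) (n / p + m * p ^ s))
      (ratio B n (n / p)) (qNum p (p ^ (s + 1))))
    (hb : ∀ n : ℕ, ∃ r : R p, ratio B n (n / p) = algebraMap (R p) (FractionRing (R p)) r)
    (hd : B 0 = 1) (hg : IsUnit (τ (truncF B 1))) :
    (∀ s : ℕ, IsUnit (τ (polyFrob p (truncF B s)))) ∧
    ∃ u : Sˣ, Tendsto (fun s : ℕ => τ (truncF B (s + 1)) *
      Ring.inverse (τ (polyFrob p (truncF B s)))) atTop (@nhds S J.adicTopology u) := by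
  obtain ⟨a, hB, ha'⟩ := exists_factorization ha hb hd
  let u : ℕ → ℕ → S := fun i s =>
    τ ((polyFrob p ^ i) (truncF B s))
  let w : ℕ → ℕ → S := fun i L =>
    τ ((polyFrob p ^ i) (blockPoly a L))
  have hw : ∀ i L, w i L ∈ J ^ L := fun i L =>
    hτ (polyFrob_pow_mem p i (blockPoly_mem ha' L))
  have hrec : ∀ i s, u i (s + 1) =
      ∑ L ∈ Finset.range (s + 1), w i L * u (i + L + 1) (s - L) := by
    intro i s
    simp only [u, w]
    rw [truncF_succ hB, map_sum, map_sum]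
    refine Finset.sum_congr rfl fun L _ => ?_
    rw [map_mul, map_mul, add_assoc, pow_add _ i (L + 1), RingHom.mul_def, RingHom.comp_apply]
  have hu0 : ∀ i, u i 0 = 1 := by
    intro i
    simp [u, truncF, hd]
  have hu1 : ∀ i, u i 1 = w i 0 := by
    intro i
    rw [hrec i 0]
    simp [hu0]
  have hw0 : ∀ i, IsUnit (w i 0) := by
    intro i
    rw [← hu1]
    -- `φ^i(F_1) ≡ F_1 ^ (p ^ i)` modulo `(p, q - 1)`.
    refine isUnit_of_sub_mem (J := J) ((hg).pow (p ^ i)) ?_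
    have := hτ
      ((pow_one (idealPoly p)).symm ▸ polyFrob_pow_sub_pow_mem p i (truncF B 1))
    rwa [pow_one, map_sub, map_pow] at this
  have hu : ∀ s i, IsUnit (u i s) := by
    intro s
    induction s with
    | zero => intro i; rw [hu0]; exact isUnit_one
    | succ s ih =>
      intro i
      refine isUnit_of_sub_mem (J := J) ((hw0 i).mul (ih (i + 1))) ?_
      rw [hrec, Finset.sum_range_succ']
      simp only [add_zero, Nat.sub_zero, add_sub_cancel_right]
      exact Ideal.sum_mem _ fun L _ => Ideal.mul_mem_right _ _
        (Ideal.pow_le_self L.succ_ne_zero (hw i (L + 1)))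
  have hφ : ∀ s, τ (polyFrob p (truncF B s)) = u 1 s := fun s => by
    simp only [u, pow_one]
  have hF : ∀ s, τ (truncF B s) = u 0 s := fun s => by
    simp only [u, pow_zero]; rfl
  refine ⟨fun s => hφ s ▸ hu s 1, ?_⟩
  simp only [hφ, hF]
  set v : ℕ → S := fun s => u 0 (s + 1) * Ring.inverse (u 1 s) with hv
  have hv' : ∀ s, v s * u 1 s = u 0 (s + 1) := fun s =>
    Ring.inverse_mul_cancel_right _ _ (hu s 1)
  have hstep : ∀ s, v (s + 1) - v s ∈ J ^ (s + 1) := by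
    intro s
    -- Dividing this congruence by the unit `u 1 (s + 1) * u 1 s` gives the Cauchy estimate.
    have h := cross_congr (fun i s => hu s i) hw hrec (s + 1) 0 1 s (by omega)
    rw [← Ideal.unit_mul_mem_iff_mem _ ((hu (s + 1) 1).mul (hu s 1))]
    rw [← hv', ← hv'] at h
    convert h using 1
    simp only [zero_add]
    ring
  obtain ⟨l, hl⟩ := exists_limit (J := J) hstep
  have hlu : IsUnit l := by
    -- `v 0` is the image of `F_1`, since `F_0 = 1`.
    refine isUnit_of_sub_mem (J := J) (y := v 0) ?_ ?_
    · have := hv' 0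
      rw [hu0, mul_one] at this
      rw [this]
      exact hu 1 0
    · rw [← neg_mem_iff, neg_sub]
      simpa using hl 0
  exact ⟨hlu.unit, tendsto_adic hl⟩

end QDwork

end

theorem theorem6p5 (p : ℕ) [Fact p.Prime] (hp : p ≠ 2) (B : ℕ → QDwork.R p)
    (ha : ∀ n m s : ℕ,
      QDwork.CongrModR (QDwork.ratio B (n + m * p ^ (s + 1)) (n / p + m * p ^ s))
        (QDwork.ratio B n (n / p)) (QDwork.qNum p (p ^ (s + 1))))
    (hb : ∀ n : ℕ, ∃ r : QDwork.R p,
      QDwork.ratio B n (n / p) = algebraMap (QDwork.R p) (FractionRing (QDwork.R p)) r)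
    (hd : B 0 = 1) :
    -- `φ(F_s)` is invertible in `T = R⟨λ, 1/F_1⟩`, so that the ratios make sense in `T`
    (∀ s : ℕ, IsUnit (QDwork.toCompl (QDwork.truncF B 1)
      (QDwork.polyFrob p (QDwork.truncF B s)))) ∧
    ∃ u : (QDwork.Compl (QDwork.truncF B 1))ˣ,
      QDwork.ConvergesTo (QDwork.truncF B 1)
        (fun s : ℕ =>
          QDwork.toCompl (QDwork.truncF B 1) (QDwork.truncF B (s + 1)) *
            Ring.inverse (QDwork.toCompl (QDwork.truncF B 1)
              (QDwork.polyFrob p (QDwork.truncF B s))))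
        (u : QDwork.Compl (QDwork.truncF B 1)) := by
  have key := QDwork.exists_unit_tendsto (S := QDwork.Compl (QDwork.truncF B 1))
    (J := QDwork.idealCompl (QDwork.truncF B 1)) (τ := QDwork.toCompl (QDwork.truncF B 1))
    (fun h => QDwork.toCompl_mem h) ha hb hd (QDwork.isUnit_toCompl_self _)
  exact key
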